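/- Let $V$ be a vector space of dimension $n$ over a field $\Bbbk$ with basis $v_1,\dots,v_n$, let $1\le d\le n$, and for $I=\{i_1<\dots<i_d\}\subseteq\{1,\dots,n\}$ put $v_I=v_{i_1}\wedge\dots\wedge v_{i_d}$. Let $\Lambda=\sum_{|I|=d}x_I v_I\in\bigwedge^d V$. Call $\Lambda$ totally decomposable if there are linearly independent $u_1,\dots,u_d\in V$ with $\Lambda=u_1\wedge\dots\wedge u_d$. For disjoint $A,B\subseteq\{1,\dots,n\}$ let $\operatorname{sgn}(A,B)$ be the signature of the permutation that sorts the sequence consisting of the elements of $A$ in increasing order followed by those of $B$ in increasing order; let $J'$ denote the complement of $J$ in $\{1,\dots,n\}$, and abbreviate $\{s\}$ to $s$ in $\operatorname{sgn}$ and in set differences. Then $\Lambda$ is totally decomposable if and only if $\Lambda\neq0$ and $$E_{KL}:=\sum_{s\in K\cap L}\operatorname{sgn}(s,K\setminus s)\,\operatorname{sgn}(s,L\setminus s)\,\operatorname{sgn}\bigl((L\setminus s)',L\setminus s\bigr)\,x_{K\setminus s}\,x_{(L\setminus s)'}=0$$ for all $K,L\subseteq\{1,\dots,n\}$ with $|K|=d+1$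 and $|L|=n-d+1$. -/

import Mathlib

namespace Pluecker

/-- `Λ ∈ ⋀^d V` is totally decomposable if `Λ = u₁ ∧ ⋯ ∧ u_d` with `u₁, …, u_d` linearly
independent. -/
def IsTotallyDecomposable {𝕜 V : Type*} [Field 𝕜] [AddCommGroup V] [Module 𝕜 V] {d : ℕ}
    (Λ : ⋀[𝕜]^d V) : Prop :=
  ∃ u : Fin d → V, LinearIndependent 𝕜 u ∧ Λ = exteriorPower.ιMulti 𝕜 d u

/-- `sgn (A, B)`: the signature of the permutation that sorts the concatenation of the increasing
sequence of the elements of `A` and the increasing sequence of the elements of `B`. (It is used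
for disjoint `A` and `B` only.) -/
def sgn {n : ℕ} (A B : Finset (Fin n)) : ℤˣ :=
  Equiv.Perm.sign (Tuple.sort (Fin.append (A.orderEmbOfFin rfl) (B.orderEmbOfFin rfl)))

/-- The coordinate `x_I` of `Λ = ∑ x_I v_I`, where `I` runs over the subsets of `{1, …, n}` with
`d` elements and `v_I` is the exterior product of the `v_i`, `i ∈ I`, in increasing order of `i`.
The value is `0` if `I` does not have `d` elements. -/
noncomputable def coord {𝕜 V : Type*} [Field 𝕜] [AddCommGroup V] [Module 𝕜 V] {n d : ℕ}
    (v : Module.Basis (Fin n) 𝕜 V) (Λ : ⋀[𝕜]^d V) (I : Finset (Fin n)) : 𝕜 :=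
  if hI : I.card = d then (v.exteriorPower d).repr Λ ⟨I, hI⟩ else 0

/-- The quadratic expression `E_{KL}` in the coordinates of `Λ`; `Jᶜ` is the sequence `J'`
complementary to `J`. -/
noncomputable def E {𝕜 V : Type*} [Field 𝕜] [AddCommGroup V] [Module 𝕜 V] {n d : ℕ}
    (v : Module.Basis (Fin n) 𝕜 V) (Λ : ⋀[𝕜]^d V) (K L : Finset (Fin n)) : 𝕜 :=
  ∑ s ∈ K ∩ L,
    ((sgn {s} (K \ {s}) * sgn {s} (L \ {s}) * sgn (L \ {s})ᶜ (L \ {s}) : ℤˣ) : 𝕜) *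
      coord v Λ (K \ {s}) * coord v Λ (L \ {s})ᶜ

end Pluecker

/-! If `Λ` is a product of vectors, its coordinates are the maximal minors of a `d × n` matrix `A`.
Up to a sign depending only on `L`, the factor attached to `(L \ s)'` is linear in column `s` of `A`
and vanishes for `s ∉ L`. So `E K L` is a linear combination of the sums `∑ s ∈ K, ± minor A (K \ s)
* A i s`, each the expansion of a determinant with a repeated row (`sum_sgn_mul_minor_mul_minor`).

Conversely, let `x_I ≠ 0`. The equations determine every coordinate from `x_I` and the coordinates
one exchange away from `I` (`eq_of_coord_exchange_eq`). Some multiple of a product of vectors has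
the same values there (`exists_coord_exchange_eq`) and also solves the equations, so it equals `Λ`.
-/

namespace Pluecker

open Finset

/-! ### Signs of shuffles as products over inversions. -/

section Sign

variable {n : ℕ}

/-- The signature of the permutation sorting an injective tuple counts the inversions. -/
theorem sign_sort_eq_prod {m : ℕ} {f : Fin m → Fin n} (hf : Function.Injective f) :
    Equiv.Perm.sign (Tuple.sort f) = ∏ j, ∏ i, if i < j ∧ f j < f i then (-1 : ℤˣ) else 1 := by
  have hmono : StrictMono (f ∘ Tuple.sort f) :=
    (Tuple.monotone_sort f).strictMono_of_injective (hf.comp (Tuple.sort f).injective)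
  rw [← Equiv.Perm.sign_inv, Equiv.Perm.sign_eq_prod_prod_Iio]
  refine Finset.prod_congr rfl fun j _ => ?_
  rw [← Finset.prod_subset (Finset.subset_univ (Finset.Iio j))]
  · refine Finset.prod_congr rfl fun i hi => ?_
    have hij := Finset.mem_Iio.1 hi
    have h : (Tuple.sort f)⁻¹ i < (Tuple.sort f)⁻¹ j ↔ f i < f j := by
      rw [← hmono.lt_iff_lt]; simp
    have hne : f i ≠ f j := fun h => hij.ne (hf h)
    by_cases h1 : f i < f j
    · rw [if_pos (h.2 h1), if_neg fun h' => lt_asymm h1 h'.2]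
    · have h2 : f j < f i := lt_of_le_of_ne (not_lt.1 h1) hne.symm
      rw [if_neg fun h' => h1 (h.1 h'), if_pos ⟨hij, h2⟩]
  · intro i _ hi
    simp only [Finset.mem_Iio] at hi
    simp [hi]

theorem prod_orderEmbOfFin {β : Type*} [CommMonoid β] {m : ℕ} (A : Finset (Fin n))
    (h : A.card = m) (g : Fin n → β) : ∏ i, g (A.orderEmbOfFin h i) = ∏ a ∈ A, g a :=
  (Finset.prod_map univ (A.orderEmbOfFin h).toEmbedding g).symm.trans
    (by rw [Finset.map_orderEmbOfFin_univ])

theorem sum_orderEmbOfFin {β : Type*} [AddCommMonoid β] {m : ℕ} (A : Finset (Fin n))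
    (h : A.card = m) (g : Fin n → β) : ∑ i, g (A.orderEmbOfFin h i) = ∑ a ∈ A, g a :=
  (Finset.sum_map univ (A.orderEmbOfFin h).toEmbedding g).symm.trans
    (by rw [Finset.map_orderEmbOfFin_univ])

/-- Both blocks are increasing, so inversions occur only between them. The product form makes `sgn`
multiplicative in each argument. -/
theorem sgn_eq_prod {A B : Finset (Fin n)} (h : Disjoint A B) :
    sgn A B = ∏ a ∈ A, ∏ b ∈ B, if b < a then (-1 : ℤˣ) else 1 := by
  have hinj : Function.Injective (Fin.append (A.orderEmbOfFin rfl) (B.orderEmbOfFin rfl)) := by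
    rw [Fin.append_injective_iff]
    refine ⟨(A.orderEmbOfFin rfl).injective, (B.orderEmbOfFin rfl).injective, fun i j hij => ?_⟩
    exact Finset.disjoint_left.1 h (A.orderEmbOfFin_mem rfl i)
      (hij ▸ B.orderEmbOfFin_mem rfl j)
  rw [sgn, sign_sort_eq_prod hinj, Fin.prod_univ_add]
  have h1 : ∀ j : Fin A.card, (∏ i, if i < Fin.castAdd B.card j ∧
      Fin.append (A.orderEmbOfFin rfl) (B.orderEmbOfFin rfl) (Fin.castAdd B.card j) <
      Fin.append (A.orderEmbOfFin rfl) (B.orderEmbOfFin rfl) i then (-1 : ℤˣ) else 1) = 1 := by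
    intro j
    refine Finset.prod_eq_one fun i _ => if_neg ?_
    refine Fin.addCases (fun i => ?_) (fun i => ?_) i
    · rw [Fin.append_left, Fin.append_left]
      rintro ⟨h1, h2⟩
      exact lt_asymm h1 ((A.orderEmbOfFin rfl).lt_iff_lt.1 h2)
    · rintro ⟨h1, -⟩
      simp only [Fin.lt_def, Fin.val_natAdd, Fin.val_castAdd] at h1
      omega
  have h2 : ∀ j : Fin B.card, (∏ i, if i < Fin.natAdd A.card j ∧
      Fin.append (A.orderEmbOfFin rfl) (B.orderEmbOfFin rfl) (Fin.natAdd A.card j) <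
      Fin.append (A.orderEmbOfFin rfl) (B.orderEmbOfFin rfl) i then (-1 : ℤˣ) else 1) =
      ∏ a ∈ A, if B.orderEmbOfFin rfl j < a then (-1 : ℤˣ) else 1 := by
    intro j
    rw [Fin.prod_univ_add, ← prod_orderEmbOfFin A rfl]
    conv_rhs => rw [← mul_one (∏ i, _)]
    congr 1
    · refine Finset.prod_congr rfl fun i _ => ?_
      rw [Fin.append_left, Fin.append_right]
      have : Fin.castAdd B.card i < Fin.natAdd A.card j := by
        simp only [Fin.lt_def, Fin.val_natAdd, Fin.val_castAdd]
        omega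
      simp [this]
    · refine Finset.prod_eq_one fun i _ => if_neg ?_
      rw [Fin.append_right, Fin.append_right]
      rintro ⟨h1, h2⟩
      exact lt_asymm h1 (by simpa using h2)
  rw [Finset.prod_eq_one fun j _ => h1 j, one_mul, Finset.prod_congr rfl fun j _ => h2 j,
    prod_orderEmbOfFin B rfl (fun b => ∏ a ∈ A, if b < a then (-1 : ℤˣ) else 1),
    Finset.prod_comm]

theorem sgn_union_left {A B C : Finset (Fin n)} (hAB : Disjoint A B) (hAC : Disjoint A C)
    (hBC : Disjoint B C) : sgn (A ∪ B) C = sgn A C * sgn B C := by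
  rw [sgn_eq_prod (Finset.disjoint_union_left.2 ⟨hAC, hBC⟩), sgn_eq_prod hAC, sgn_eq_prod hBC,
    Finset.prod_union hAB]

theorem sgn_union_right {A B C : Finset (Fin n)} (hAB : Disjoint A B) (hAC : Disjoint A C)
    (hBC : Disjoint B C) : sgn A (B ∪ C) = sgn A B * sgn A C := by
  rw [sgn_eq_prod (Finset.disjoint_union_right.2 ⟨hAB, hAC⟩), sgn_eq_prod hAB, sgn_eq_prod hAC,
    ← Finset.prod_mul_distrib]
  exact Finset.prod_congr rfl fun a _ => Finset.prod_union hBC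

theorem sgn_swap {A B : Finset (Fin n)} (h : Disjoint A B) :
    sgn A B = (-1) ^ (A.card * B.card) * sgn B A := by
  have hpow : ((-1 : ℤˣ)) ^ (A.card * B.card) = ∏ _a ∈ A, ∏ _b ∈ B, (-1 : ℤˣ) := by
    simp [pow_mul']
  rw [sgn_eq_prod h, sgn_eq_prod h.symm, Finset.prod_comm (s := B), hpow,
    ← Finset.prod_mul_distrib]
  refine Finset.prod_congr rfl fun a ha => ?_
  rw [← Finset.prod_mul_distrib]
  refine Finset.prod_congr rfl fun b hb => ?_
  have hne : a ≠ b := fun hab => Finset.disjoint_left.1 h ha (hab ▸ hb)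
  rcases lt_or_gt_of_ne hne with h1 | h1
  · simp [h1, h1.le]
  · simp [h1, h1.le]

theorem card_sdiff_orderEmbOfFin {m : ℕ} (K : Finset (Fin n)) (h : K.card = m + 1)
    (j : Fin (m + 1)) : (K \ {K.orderEmbOfFin h j}).card = m := by
  rw [Finset.card_sdiff_of_subset (by simp), h]; simp

theorem orderEmbOfFin_sdiff_singleton {m : ℕ} (K : Finset (Fin n)) (h : K.card = m + 1)
    (j : Fin (m + 1)) (h' : (K \ {K.orderEmbOfFin h j}).card = m) (i : Fin m) :
    (K \ {K.orderEmbOfFin h j}).orderEmbOfFin h' i = K.orderEmbOfFin h (j.succAbove i) := by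
  refine (congr_fun (Finset.orderEmbOfFin_unique h'
    (f := fun i => K.orderEmbOfFin h (j.succAbove i)) (fun i => ?_) ?_) i).symm
  · simp [Fin.succAbove_ne]
  · exact (K.orderEmbOfFin h).strictMono.comp (Fin.strictMono_succAbove j)

theorem sgn_singleton_sdiff {m : ℕ} (K : Finset (Fin n)) (h : K.card = m + 1)
    (j : Fin (m + 1)) :
    sgn {K.orderEmbOfFin h j} (K \ {K.orderEmbOfFin h j}) = (-1) ^ (j : ℕ) := by
  rw [sgn_eq_prod Finset.disjoint_sdiff, Finset.prod_singleton]
  have : (∏ b ∈ K, if b < K.orderEmbOfFin h j then (-1 : ℤˣ) else 1) =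
      ∏ b ∈ K \ {K.orderEmbOfFin h j}, if b < K.orderEmbOfFin h j then (-1 : ℤˣ) else 1 := by
    refine (Finset.prod_subset Finset.sdiff_subset fun b hb hb' => if_neg ?_).symm
    have : b = K.orderEmbOfFin h j := by simpa [hb] using hb'
    simp [this]
  rw [← this, ← prod_orderEmbOfFin K h, Finset.prod_ite]
  have hIio : (univ.filter fun x => x < j) = Iio j := by ext; simp
  simp [hIio]

end Sign

/-! ### Quadratic relations between maximal minors. -/

section Minor

variable {𝕜 : Type*} [Field 𝕜] {n d : ℕ}

/-- The maximal minor of a matrix on the columns in `K`, and `0` if `K` has the wrong size. -/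
noncomputable def minor (A : Matrix (Fin d) (Fin n) 𝕜) (K : Finset (Fin n)) : 𝕜 :=
  if h : K.card = d then (A.submatrix id (K.orderEmbOfFin h)).det else 0

theorem minor_of_card (A : Matrix (Fin d) (Fin n) 𝕜) {K : Finset (Fin n)} (h : K.card = d) :
    minor A K = (A.submatrix id (K.orderEmbOfFin h)).det := dif_pos h

/-- Repeat row `i` on top of the columns `K` of `A` and expand the vanishing determinant along that
row. -/
theorem sum_sgn_mul_minor_sdiff (A : Matrix (Fin d) (Fin n) 𝕜) {K : Finset (Fin n)}
    (h : K.card = d + 1) (i : Fin d) :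
    ∑ s ∈ K, ((sgn {s} (K \ {s}) : ℤˣ) : 𝕜) * minor A (K \ {s}) * A i s = 0 := by
  have hdet : (Matrix.of (Fin.cons (A i) A : Fin (d + 1) → Fin n → 𝕜)
      |>.submatrix id (K.orderEmbOfFin h)).det = 0 :=
    Matrix.det_zero_of_row_eq (i := 0) (j := i.succ) (Fin.succ_ne_zero i).symm (by
      rfl)
  rw [Matrix.det_succ_row_zero] at hdet
  rw [← sum_orderEmbOfFin K h, ← hdet]
  refine Finset.sum_congr rfl fun j _ => ?_
  rw [sgn_singleton_sdiff, minor_of_card A (card_sdiff_orderEmbOfFin K h j)]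
  have : A.submatrix id ((K \ {K.orderEmbOfFin h j}).orderEmbOfFin
      (card_sdiff_orderEmbOfFin K h j)) =
      ((Matrix.of (Fin.cons (A i) A : Fin (d + 1) → Fin n → 𝕜)).submatrix id
        (K.orderEmbOfFin h)).submatrix Fin.succ j.succAbove := by
    ext a b
    simp only [Matrix.submatrix_apply, id, orderEmbOfFin_sdiff_singleton]
    rfl
  rw [this]
  have hrow : (Matrix.of (Fin.cons (A i) A : Fin (d + 1) → Fin n → 𝕜)).submatrix id
      (K.orderEmbOfFin h) 0 j = A i (K.orderEmbOfFin h j) := rfl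
  rw [hrow]
  push_cast
  ring

/-- The `c i` are the cofactors of a column `s` placed in front of the columns `M`. They do not
depend on `s`, and for `s ∈ M` a column repeats. -/
theorem exists_minor_insert_eq_sum (A : Matrix (Fin d) (Fin n) 𝕜) {M : Finset (Fin n)}
    (hM : M.card + 1 = d) :
    ∃ c : Fin d → 𝕜, (∀ s ∉ M, ((sgn {s} M : ℤˣ) : 𝕜) * minor A (insert s M) =
      ∑ i, c i * A i s) ∧ ∀ s ∈ M, ∑ i, c i * A i s = 0 := by
  subst hM
  refine ⟨fun i => (-1) ^ (i : ℕ) * (A.submatrix i.succAbove (M.orderEmbOfFin rfl)).det,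
    fun s hs => ?_, fun s hs => ?_⟩
  · have hcard : (insert s M).card = M.card + 1 := Finset.card_insert_of_notMem hs
    obtain ⟨j, hj⟩ : ∃ j, (insert s M).orderEmbOfFin hcard j = s := by
      have : s ∈ Set.range ((insert s M).orderEmbOfFin hcard) := by simp
      exact this
    have hMs : insert s M \ {s} = M := by
      ext t; simp only [mem_sdiff, mem_insert, mem_singleton]; grind
    have hsgn := sgn_singleton_sdiff (insert s M) hcard j
    rw [hj, hMs] at hsgn
    have hemb : ∀ i, M.orderEmbOfFin rfl i =
        (insert s M).orderEmbOfFin hcard (j.succAbove i) := by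
      intro i
      have h' := card_sdiff_orderEmbOfFin (insert s M) hcard j
      rw [← orderEmbOfFin_sdiff_singleton (insert s M) hcard j h' i]
      congr! 2
      rw [hj, hMs]
    rw [hsgn, minor_of_card A hcard, Matrix.det_succ_column _ j, Finset.mul_sum]
    refine Finset.sum_congr rfl fun i _ => ?_
    have : A.submatrix i.succAbove (M.orderEmbOfFin rfl) =
        (A.submatrix id ((insert s M).orderEmbOfFin hcard)).submatrix i.succAbove
          j.succAbove := by
      ext a b
      simp [hemb]
    beta_reduce
    rw [this]
    simp only [Matrix.submatrix_apply, id, hj]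
    push_cast
    rw [pow_add]
    have hsq : ((-1 : 𝕜) ^ (j : ℕ)) * (-1) ^ (j : ℕ) = 1 := by
      rw [← mul_pow]; simp
    linear_combination ((-1 : 𝕜) ^ (i : ℕ) * A i s * Matrix.det ((A.submatrix id
      ((insert s M).orderEmbOfFin hcard)).submatrix i.succAbove j.succAbove)) * hsq
  · obtain ⟨j, hj⟩ : ∃ j, M.orderEmbOfFin rfl j = s := by
      have : s ∈ Set.range (M.orderEmbOfFin rfl) := by simpa using hs
      exact this
    have hdet : (A.submatrix id (Fin.cons s (M.orderEmbOfFin rfl) :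
        Fin (M.card + 1) → Fin n)).det = 0 :=
      Matrix.det_zero_of_column_eq (i := 0) (j := j.succ) (Fin.succ_ne_zero j).symm (by
        intro k; simp [hj])
    rw [Matrix.det_succ_column_zero] at hdet
    rw [← hdet]
    refine Finset.sum_congr rfl fun i _ => ?_
    have : A.submatrix i.succAbove (M.orderEmbOfFin rfl) =
        (A.submatrix id (Fin.cons s (M.orderEmbOfFin rfl) :
        Fin (M.card + 1) → Fin n)).submatrix i.succAbove Fin.succ := by
      ext a b
      simp
    beta_reduce
    rw [this, Matrix.submatrix_apply, Fin.cons_zero, id]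
    ring

/-- The product of the three signs in `E`, in terms of the complement of `L`. -/
theorem sgn_mul_sgn_compl {L : Finset (Fin n)} {s : Fin n} (hs : s ∈ L) :
    sgn {s} (L \ {s}) * sgn (L \ {s})ᶜ (L \ {s}) =
      sgn Lᶜ L * (-1) ^ (Lᶜ).card * sgn {s} Lᶜ := by
  have h1 : (L \ {s})ᶜ = {s} ∪ Lᶜ := by
    ext t; simp only [mem_compl, mem_sdiff, mem_union, mem_singleton]; tauto
  have h2 : L = {s} ∪ (L \ {s}) := by
    ext t; simp only [mem_sdiff, mem_union, mem_singleton]; grind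
  have d1 : Disjoint {s} Lᶜ := by simpa using hs
  have d2 : Disjoint {s} (L \ {s}) := disjoint_sdiff
  have d3 : Disjoint Lᶜ (L \ {s}) := disjoint_compl_left.mono_right sdiff_subset
  rw [h1, sgn_union_left d1 d2 d3]
  have h3 : sgn Lᶜ L = sgn Lᶜ {s} * sgn Lᶜ (L \ {s}) := by
    rw [← sgn_union_right d1.symm d3 d2, ← h2]
  rw [h3, sgn_swap d1.symm]
  have h4 : sgn {s} (L \ {s}) * sgn {s} (L \ {s}) = 1 := Int.units_mul_self _
  have h5 : sgn {s} Lᶜ * sgn {s} Lᶜ = 1 := Int.units_mul_self _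
  have h6 : ((-1 : ℤˣ) ^ (Lᶜ).card) * (-1) ^ (Lᶜ).card = 1 := Int.units_mul_self _
  rw [card_singleton, mul_one]
  calc _ = sgn {s} (L \ {s}) * sgn {s} (L \ {s}) * sgn Lᶜ (L \ {s}) := by
        simp only [mul_assoc]
    _ = (((-1 : ℤˣ) ^ (Lᶜ).card) * (-1) ^ (Lᶜ).card) * (sgn {s} Lᶜ * sgn {s} Lᶜ) *
        sgn Lᶜ (L \ {s}) := by simp only [h4, h5, h6, one_mul]
    _ = _ := by ac_rfl

theorem sum_sgn_mul_minor_mul_minor (A : Matrix (Fin d) (Fin n) 𝕜) {K L : Finset (Fin n)}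
    (hK : K.card = d + 1) (hL : (Lᶜ).card + 1 = d) :
    ∑ s ∈ K ∩ L,
      ((sgn {s} (K \ {s}) * sgn {s} (L \ {s}) * sgn (L \ {s})ᶜ (L \ {s}) : ℤˣ) : 𝕜) *
        minor A (K \ {s}) * minor A (L \ {s})ᶜ = 0 := by
  obtain ⟨c, hc, hc'⟩ := exists_minor_insert_eq_sum A hL
  have key : ∀ s ∈ K ∩ L,
      ((sgn {s} (K \ {s}) * sgn {s} (L \ {s}) * sgn (L \ {s})ᶜ (L \ {s}) : ℤˣ) : 𝕜) *
        minor A (K \ {s}) * minor A (L \ {s})ᶜ =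
      ((sgn Lᶜ L * (-1) ^ (Lᶜ).card : ℤˣ) : 𝕜) *
        (((sgn {s} (K \ {s}) : ℤˣ) : 𝕜) * minor A (K \ {s}) * ∑ i, c i * A i s) := by
    intro s hs
    have hsL := (mem_inter.1 hs).2
    have h1 : (L \ {s})ᶜ = insert s Lᶜ := by
      ext t; simp only [mem_compl, mem_sdiff, mem_insert, mem_singleton]; tauto
    rw [mul_assoc (sgn {s} (K \ {s})), sgn_mul_sgn_compl hsL, h1, ← hc s (by simpa using hsL)]
    push_cast
    ring
  rw [Finset.sum_congr rfl key, ← Finset.mul_sum]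
  have hsub : ∑ s ∈ K ∩ L, (((sgn {s} (K \ {s}) : ℤˣ) : 𝕜) * minor A (K \ {s}) *
      ∑ i, c i * A i s) = ∑ s ∈ K, (((sgn {s} (K \ {s}) : ℤˣ) : 𝕜) * minor A (K \ {s}) *
      ∑ i, c i * A i s) := by
    -- An `s` in `K` but not in `L` lies in `Lᶜ`, where the linear form vanishes.
    refine Finset.sum_subset inter_subset_left fun s hs hs' => ?_
    rw [hc' s (by simpa [hs] using hs'), mul_zero]
  rw [hsub]
  refine mul_eq_zero_of_right _ ?_
  simp_rw [Finset.mul_sum]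
  rw [Finset.sum_comm]
  refine Finset.sum_eq_zero fun i _ => ?_
  rw [← mul_zero (c i), ← sum_sgn_mul_minor_sdiff A hK i, Finset.mul_sum]
  exact Finset.sum_congr rfl fun s _ => by ring

end Minor

/-! ### Coordinates of `Λ` and reconstruction of its factors. -/

section Coord

variable {𝕜 V : Type*} [Field 𝕜] [AddCommGroup V] [Module 𝕜 V] {n d : ℕ}
  (v : Module.Basis (Fin n) 𝕜 V)

theorem coord_of_card (Λ : ⋀[𝕜]^d V) {I : Finset (Fin n)} (hI : I.card = d) :
    coord v Λ I = exteriorPower.pairingDual 𝕜 V d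
      (exteriorPower.ιMulti 𝕜 d (v.coord ∘ I.orderEmbOfFin hI)) Λ := by
  rw [coord, dif_pos hI, exteriorPower.basis_repr_apply]
  rfl

theorem coord_ιMulti (u : Fin d → V) (I : Finset (Fin n)) :
    coord v (exteriorPower.ιMulti 𝕜 d u) I =
      minor (Matrix.of fun i s => v.repr (u i) s) I := by
  by_cases hI : I.card = d
  · rw [coord_of_card v _ hI, exteriorPower.pairingDual_ιMulti_ιMulti, minor_of_card _ hI]
    rfl
  · simp [coord, minor, hI]

theorem coord_smul (c : 𝕜) (Λ : ⋀[𝕜]^d V) (I : Finset (Fin n)) :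
    coord v (c • Λ) I = c * coord v Λ I := by
  by_cases hI : I.card = d <;> simp [coord, hI]

theorem E_ιMulti (hd : 1 ≤ d) (hdn : d ≤ n) (u : Fin d → V) {K L : Finset (Fin n)}
    (hK : K.card = d + 1) (hL : L.card = n - d + 1) :
    E v (exteriorPower.ιMulti 𝕜 d u) K L = 0 := by
  simp only [E, coord_ιMulti]
  refine sum_sgn_mul_minor_mul_minor _ hK ?_
  rw [Finset.card_compl, Fintype.card_fin]
  omega

theorem E_smul (c : 𝕜) (Λ : ⋀[𝕜]^d V) (K L : Finset (Fin n)) :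
    E v (c • Λ) K L = c ^ 2 * E v Λ K L := by
  simp only [E, coord_smul, Finset.mul_sum]
  exact Finset.sum_congr rfl fun s _ => by ring

theorem ext_coord {Λ Λ' : ⋀[𝕜]^d V}
    (h : ∀ I : Finset (Fin n), I.card = d → coord v Λ I = coord v Λ' I) : Λ = Λ' := by
  refine (v.exteriorPower d).ext_elem fun I => ?_
  have hI : I.val.card = d := I.prop
  simpa [coord, hI] using h I.val hI

/-- Solutions of the quadratic equations are determined by the coordinates `x_I ≠ 0` and the
`x_J` for which `J` is obtained from `I` by exchanging one element. -/
theorem eq_of_coord_exchange_eq (hdn : d ≤ n) {Λ Λ' : ⋀[𝕜]^d V}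
    (hE : ∀ K L : Finset (Fin n), K.card = d + 1 → L.card = n - d + 1 → E v Λ K L = 0)
    (hE' : ∀ K L : Finset (Fin n), K.card = d + 1 → L.card = n - d + 1 → E v Λ' K L = 0)
    {I : Finset (Fin n)} (hI : I.card = d) (h0 : coord v Λ I ≠ 0)
    (hII : coord v Λ I = coord v Λ' I)
    (hex : ∀ i ∈ I, ∀ j ∉ I, coord v Λ (insert j I \ {i}) = coord v Λ' (insert j I \ {i})) :
    Λ = Λ' := by
  refine ext_coord v fun J hJ => ?_
  induction hm : (J \ I).card generalizing J with
  | zero =>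
    have hsub : J ⊆ I := by rwa [card_eq_zero, sdiff_eq_empty_iff_subset] at hm
    rw [Finset.eq_of_subset_of_card_le hsub (by rw [hI, hJ]), hII]
  | succ m ih =>
    obtain ⟨j, hj⟩ : (J \ I).Nonempty := by rw [← card_pos]; omega
    obtain ⟨hjJ, hjI⟩ := mem_sdiff.1 hj
    -- With `K = I ∪ {j}` and `L = (J \ {j})ᶜ`, the term `s = j` of `E` is `± x_I * x_J`.
    have hK : (insert j I).card = d + 1 := by rw [card_insert_of_notMem hjI, hI]
    have hL : ((J.erase j)ᶜ).card = n - d + 1 := by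
      have : 0 < J.card := card_pos.2 ⟨j, hjJ⟩
      rw [card_compl, card_erase_of_mem hjJ, Fintype.card_fin]
      omega
    have e := hE _ _ hK hL
    have e' := hE' _ _ hK hL
    have hmem : j ∈ insert j I ∩ (J.erase j)ᶜ := by simp
    rw [E, ← Finset.add_sum_erase _ _ hmem] at e e'
    -- Any other `s` lies in `I \ J`: the first index set is then one exchange away from `I`, and
    -- the second, `J` with `j` replaced by `s`, has one element fewer outside `I`.
    have hrest : ∀ s ∈ (insert j I ∩ (J.erase j)ᶜ).erase j,
        coord v Λ (insert j I \ {s}) = coord v Λ' (insert j I \ {s}) ∧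
        coord v Λ ((J.erase j)ᶜ \ {s})ᶜ = coord v Λ' ((J.erase j)ᶜ \ {s})ᶜ := by
      intro s hs
      simp only [mem_erase, mem_inter, mem_insert, mem_compl] at hs
      obtain ⟨hsj, hsI, hsJ⟩ := hs
      have hsI : s ∈ I := hsI.resolve_left hsj
      have hsJ : s ∉ J := fun h => hsJ ⟨hsj, h⟩
      have hset : ((J.erase j)ᶜ \ {s})ᶜ = insert s (J.erase j) := by
        ext t; simp only [mem_compl, mem_sdiff, mem_insert, mem_singleton]; tauto
      refine ⟨hex s hsI j hjI, ?_⟩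
      rw [hset]
      refine ih _ ?_ ?_
      · rw [card_insert_of_notMem (by simp [hsJ]), card_erase_of_mem hjJ]
        have : 0 < J.card := card_pos.2 ⟨j, hjJ⟩
        omega
      · have : insert s (J.erase j) \ I = (J \ I).erase j := by
          ext t; simp only [mem_sdiff, mem_insert, mem_erase]; grind
        rw [this, card_erase_of_mem hj, hm]
        rfl
    rw [Finset.sum_congr rfl fun s hs => by rw [(hrest s hs).1, (hrest s hs).2]] at e
    have hKj : insert j I \ {j} = I := by
      ext t; simp only [mem_sdiff, mem_insert, mem_singleton]; grind
    have hLj : ((J.erase j)ᶜ \ {j})ᶜ = J := by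
      ext t; simp only [mem_compl, mem_sdiff, mem_erase, mem_singleton]; grind
    have hee := add_right_cancel (e.trans e'.symm)
    rw [hKj, hLj, ← hII] at hee
    refine mul_left_cancel₀ (mul_ne_zero ?_ h0) hee
    rcases Int.units_eq_one_or (sgn {j} I * sgn {j} ((J.erase j)ᶜ \ {j}) *
      sgn J ((J.erase j)ᶜ \ {j})) with h | h <;> rw [h] <;> simp

/-- The alternating extension of the coordinates of `Λ` to all sequences of indices. -/
noncomputable def seqCoord (Λ : ⋀[𝕜]^d V) (f : Fin d → Fin n) : 𝕜 :=
  exteriorPower.pairingDual 𝕜 V d (exteriorPower.ιMulti 𝕜 d (v.coord ∘ f)) Λ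

theorem seqCoord_eq_zero (Λ : ⋀[𝕜]^d V) {f : Fin d → Fin n} {i j : Fin d} (hij : i ≠ j)
    (h : f i = f j) : seqCoord v Λ f = 0 := by
  rw [seqCoord, AlternatingMap.map_eq_zero_of_eq _ _ (by simp [h]) hij]
  simp

theorem seqCoord_ιMulti (u : Fin d → V) (f : Fin d → Fin n) :
    seqCoord v (exteriorPower.ιMulti 𝕜 d u) f =
      (Matrix.of fun i j => v.repr (u i) (f j)).det := by
  rw [seqCoord, exteriorPower.pairingDual_ιMulti_ιMulti]
  rfl

theorem seqCoord_smul (c : 𝕜) (Λ : ⋀[𝕜]^d V) (f : Fin d → Fin n) :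
    seqCoord v (c • Λ) f = c * seqCoord v Λ f := by
  simp [seqCoord]

/-- Since `ε` is the same for all `Λ`, it cancels when two vectors are compared and need not be
computed. -/
theorem exists_seqCoord_eq_smul_coord {f : Fin d → Fin n} (hf : Function.Injective f)
    {J : Finset (Fin n)} (hJ : J.card = d) (hfJ : ∀ i, f i ∈ J) :
    ∃ ε : ℤˣ, ∀ Λ : ⋀[𝕜]^d V, seqCoord v Λ f = ε • coord v Λ J := by
  have hinj : Function.Injective fun i => (J.orderIsoOfFin hJ).symm ⟨f i, hfJ i⟩ :=
    fun i j h => hf (by simpa using h)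
  let σ : Equiv.Perm (Fin d) := Equiv.ofBijective _ (Finite.injective_iff_bijective.1 hinj)
  have hσ : f = J.orderEmbOfFin hJ ∘ σ := by
    funext i
    simp [σ, ← Finset.coe_orderIsoOfFin_apply]
  refine ⟨Equiv.Perm.sign σ, fun Λ => ?_⟩
  rw [coord_of_card v Λ hJ, seqCoord, hσ, ← Function.comp_assoc, AlternatingMap.map_perm]
  rcases Int.units_eq_one_or (Equiv.Perm.sign σ) with h | h <;> rw [h] <;> simp

theorem exists_coord_exchange_eq (Λ : ⋀[𝕜]^d V) {I : Finset (Fin n)} (hI : I.card = d)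
    (h0 : coord v Λ I ≠ 0) :
    ∃ u : Fin d → V, coord v Λ I = coord v (coord v Λ I • exteriorPower.ιMulti 𝕜 d u) I ∧
      ∀ i ∈ I, ∀ j ∉ I, coord v Λ (insert j I \ {i}) =
        coord v (coord v Λ I • exteriorPower.ιMulti 𝕜 d u) (insert j I \ {i}) := by
  set e := I.orderEmbOfFin hI with he
  have hx : seqCoord v Λ e = coord v Λ I := (coord_of_card v Λ hI).symm
  set x := coord v Λ I
  -- If `Λ` is decomposable, its factors can be normalised to have the identity matrix on the
  -- columns `I`. Entry `(k, s)` is then the minor with the `k`-th column of `I` replaced by `s`,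
  -- which is the formula used here.
  let u : Fin d → V := fun k => v.equivFun.symm fun s =>
    x⁻¹ * seqCoord v Λ (Function.update e k s)
  have hu : ∀ k s, v.repr (u k) s = x⁻¹ * seqCoord v Λ (Function.update e k s) := fun k s =>
    congrFun (v.equivFun.apply_symm_apply _) s
  have hone : ∀ k l, v.repr (u k) (e l) = (1 : Matrix (Fin d) (Fin d) 𝕜) k l := by
    intro k l
    rw [hu]
    by_cases hkl : k = l
    · subst hkl
      rw [Function.update_eq_self, hx, inv_mul_cancel₀ h0, Matrix.one_apply_eq]
    · rw [seqCoord_eq_zero v Λ hkl (by simp [Ne.symm hkl]), mul_zero, Matrix.one_apply_ne hkl]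
  refine ⟨u, ?_, fun i hi j hj => ?_⟩
  · rw [coord_smul, coord_of_card v _ hI]
    change x = x * seqCoord v (exteriorPower.ιMulti 𝕜 d u) e
    have : (Matrix.of fun i j => v.repr (u i) (e j)) = 1 := by
      ext k l; exact hone k l
    rw [seqCoord_ιMulti, this, Matrix.det_one, mul_one]
  · obtain ⟨k, rfl⟩ : ∃ k, e k = i := by
      have : i ∈ Set.range e := by simpa [he] using hi
      exact this
    have heI : ∀ l, e l ∈ I := fun l => Finset.orderEmbOfFin_mem I hI l
    have hinj : Function.Injective (Function.update e k j) := by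
      intro a b hab
      by_cases ha : a = k <;> by_cases hb : b = k
      · rw [ha, hb]
      · subst ha
        rw [Function.update_self, Function.update_of_ne hb] at hab
        exact absurd (hab ▸ heI b) hj
      · subst hb
        rw [Function.update_self, Function.update_of_ne ha] at hab
        exact absurd (hab ▸ heI a) hj
      · rw [Function.update_of_ne ha, Function.update_of_ne hb] at hab
        exact e.injective hab
    have hJ : (insert j I \ {e k}).card = d := by
      rw [card_sdiff_of_subset (by simp [heI]), card_insert_of_notMem hj, hI]; simp
    have hmem : ∀ l, Function.update e k j l ∈ insert j I \ {e k} := by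
      intro l
      by_cases hl : l = k
      · subst hl
        have : j ≠ e l := fun h => hj (h ▸ heI l)
        simp [this]
      · simp [hl, heI]
    obtain ⟨ε, hε⟩ := exists_seqCoord_eq_smul_coord (𝕜 := 𝕜) v hinj hJ hmem
    have key : seqCoord v Λ (Function.update e k j) =
        seqCoord v (x • exteriorPower.ιMulti 𝕜 d u) (Function.update e k j) := by
      rw [seqCoord_smul, seqCoord_ιMulti]
      have : (Matrix.of fun a b => v.repr (u a) (Function.update e k j b)) =
          (1 : Matrix (Fin d) (Fin d) 𝕜).updateCol k fun a => v.repr (u a) j := by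
        ext a b
        by_cases hb : b = k
        · subst hb; simp
        · simp [hb, hone]
      -- The identity matrix with column `k` replaced by `b` has determinant `b k`.
      rw [this, ← Matrix.cramer_apply, Matrix.cramer_one, Module.End.one_apply, hu, ← mul_assoc,
        mul_inv_cancel₀ h0, one_mul]
    rw [hε, hε] at key
    exact smul_left_cancel ε key

/-- The product of all `d` vectors belongs to the linearly independent family of products of `d` of
the `u i`. -/
theorem ιMulti_ne_zero {u : Fin d → V} (hu : LinearIndependent 𝕜 u) :
    exteriorPower.ιMulti 𝕜 d u ≠ 0 := by
  have h := (exteriorPower.ιMulti_family_linearIndependent_field (n := d) hu).ne_zero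
    ⟨Finset.univ, Finset.card_fin d⟩
  have hid : ⇑((univ : Finset (Fin d)).orderEmbOfFin (Finset.card_fin d)) = id :=
    (Finset.orderEmbOfFin_unique (Finset.card_fin d) (by simp) strictMono_id).symm
  rw [exteriorPower.ιMulti_family] at h
  convert h using 2
  exact (congrArg (u ∘ ·) hid).symm

/-- The scalar is absorbed into the first vector, which exists as `1 ≤ d`; dependent factors would
make the product zero. -/
theorem isTotallyDecomposable_smul_ιMulti (hd : 1 ≤ d) {c : 𝕜} {u : Fin d → V}
    (h : c • exteriorPower.ιMulti 𝕜 d u ≠ 0) :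
    IsTotallyDecomposable (c • exteriorPower.ιMulti 𝕜 d u) := by
  have heq : c • exteriorPower.ιMulti 𝕜 d u =
      exteriorPower.ιMulti 𝕜 d (Function.update u ⟨0, hd⟩ (c • u ⟨0, hd⟩)) := by
    rw [AlternatingMap.map_update_smul, Function.update_eq_self]
  refine ⟨_, ?_, heq⟩
  by_contra hli
  exact h (heq.trans (AlternatingMap.map_linearDependent _ _ hli))

end Coord

end Pluecker

theorem mainTheorem1 {𝕜 V : Type*} [Field 𝕜] [AddCommGroup V] [Module 𝕜 V] {n d : ℕ}
    (hd : 1 ≤ d) (hdn : d ≤ n) (v : Module.Basis (Fin n) 𝕜 V) (Λ : ⋀[𝕜]^d V) :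
    Pluecker.IsTotallyDecomposable Λ ↔
      Λ ≠ 0 ∧ ∀ K L : Finset (Fin n), K.card = d + 1 → L.card = n - d + 1 →
        Pluecker.E v Λ K L = 0 := by
  constructor
  · rintro ⟨u, hu, rfl⟩
    exact ⟨Pluecker.ιMulti_ne_zero hu, fun K L hK hL => Pluecker.E_ιMulti v hd hdn u hK hL⟩
  · rintro ⟨h0, hE⟩
    obtain ⟨I, hI, hxI⟩ : ∃ I : Finset (Fin n), I.card = d ∧ Pluecker.coord v Λ I ≠ 0 := by
      by_contra! h
      refine h0 (Pluecker.ext_coord v fun I hI => ?_)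
      rw [h I hI, ← zero_smul 𝕜 Λ, Pluecker.coord_smul, zero_mul]
    obtain ⟨u, hII, hex⟩ := Pluecker.exists_coord_exchange_eq v Λ hI hxI
    have heq := Pluecker.eq_of_coord_exchange_eq v hdn hE
      (fun K L hK hL => by rw [Pluecker.E_smul, Pluecker.E_ιMulti v hd hdn u hK hL, mul_zero])
      hI hxI hII hex
    rw [heq] at h0 ⊢
    exact Pluecker.isTotallyDecomposable_smul_ιMulti hd h0
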